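/- Let $\oplus$ denote bitwise exclusive or. Say that $f:\{0,1\}^n\to\{0,1\}^m$ hides $S\subseteq\{0,1\}^n$ if for all $x,y$: $f(x)=f(y)\iff x\oplus y\in S$ (then $S$ is a subgroup). The generalized Simon's problem with parameters $n,m,k$, where $1\le k\le n\le m$, is: given oracle access to a function $f:\{0,1\}^n\to\{0,1\}^m$ that hides a set $S$ with $|S|=2^k$, find $S$. A quantum algorithm with $T$ queries applies $U_T\,O_f\,U_{T-1}\cdots O_f\,U_0$ to a fixed basis state, where $O_f|x,y,z\rangle=|x,y\oplus f(x),z\rangle$ and the unitaries $U_i$ do not depend on $f$, and its output is a function of the result of a final measurement in the computational basis. It solves the problem with error $\varepsilon$ if, for every $f$ that hides a set $S$ with $|S|=2^k$, it outputs $S$ with probability at least $1-\varepsilon$. Let $0\le\varepsilon<\tfrac12$. Every quantum algorithm that solves the generalized Simon's problem with error $\varepsilon$ makes $$T\ \ge\ \min\left(\frac{n-k}{4},\ \frac{n-k+3+\log_2(1-2\varepsilon)}{8}\right)$$ queries; and $T=\Omega(n-k)$, that is, $T\ge c\,(n-k)$ with a constant $c>0$ that depends only on $\varepsilon$. The same two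 bounds (with the same $c$) hold for every quantum algorithm that merely distinguishes with error $\varepsilon$, i.e. that accepts every $f$ hiding a subgroup of order $2^k$ with probability at least $1-\varepsilon$ and rejects every $f$ hiding the trivial subgroup $\{0^n\}$ (that is, every injective $f$) with probability at least $1-\varepsilon$. -/

import Mathlib

noncomputable section

namespace GenSimon

/-- The group `{0,1}^n`; since the entries lie in `ZMod 2`, addition is bitwise exclusive or. -/
abbrev Cube (n : ℕ) : Type := Fin n → ZMod 2

/-- `f` hides `S`: for all `x, y`, `f x = f y` if and only if `x ⊕ y ∈ S`.
(This forces `S` to be a subgroup of `{0,1}^n`.) -/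
def Hides {n m : ℕ} (f : Cube n → Cube m) (S : Set (Cube n)) : Prop :=
  ∀ x y : Cube n, f x = f y ↔ x + y ∈ S

/-- Labels `|x, y, z⟩` of the computational basis: a query register `x ∈ {0,1}^n`, an answer
register `y ∈ {0,1}^m`, and a work register with `w` basis states. -/
abbrev Label (n m w : ℕ) : Type := Cube n × Cube m × Fin w

/-- The oracle `O_f |x, y, z⟩ = |x, y ⊕ f x, z⟩`, acting on vectors of amplitudes (the amplitude of
`|x, y, z⟩` after the query is that of `|x, y ⊕ f x, z⟩` before it, as `O_f` is an involution). -/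
def oracle {n m w : ℕ} (f : Cube n → Cube m) (ψ : Label n m w → ℂ) : Label n m w → ℂ :=
  fun b => ψ (b.1, b.2.1 + f b.1, b.2.2)

/-- A quantum query algorithm with oracle access to functions `{0,1}^n → {0,1}^m` and with outputs
in `Out`: it starts in a basis state, applies `U_0, O_f, U_1, O_f, …, O_f, U_T` with `T = queries`
and unitaries that do not depend on `f`, measures in the computational basis, and outputs a function
of the result. -/
structure QueryAlgorithm (n m : ℕ) (Out : Type) where
  /-- number of basis states of the work register -/
  work : ℕ
  /-- number of oracle queries -/
  queries : ℕ
  /-- initial basis state -/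
  start : Label n m work
  /-- the unitaries; only those with index at most `queries` are used -/
  U : ℕ → Matrix.unitaryGroup (Label n m work) ℂ
  /-- output as a function of the measurement result -/
  output : Label n m work → Out

namespace QueryAlgorithm

variable {n m : ℕ} {Out : Type}

/-- The state `U_t O_f U_{t-1} ⋯ O_f U_0 |start⟩`, after `t` queries to `f`. -/
def state (A : QueryAlgorithm n m Out) (f : Cube n → Cube m) : ℕ → Label n m A.work → ℂ
  | 0 => Matrix.mulVec (A.U 0).1 (Pi.single A.start 1)
  | t + 1 => Matrix.mulVec (A.U (t + 1)).1 (oracle f (A.state f t))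

open Classical in
/-- The probability that `A` outputs `o` when its oracle is `f`. -/
def prob (A : QueryAlgorithm n m Out) (f : Cube n → Cube m) (o : Out) : ℝ :=
  ∑ b : Label n m A.work, if A.output b = o then ‖A.state f A.queries b‖ ^ 2 else 0

/-- `A` solves the generalized Simon problem with error at most `ε`: whenever `f` hides a set `S` with
`2^k` elements, `A` outputs `S` with probability at least `1 - ε`. -/
def Solves (A : QueryAlgorithm n m (Set (Cube n))) (k : ℕ) (ε : ℝ) : Prop :=
  ∀ (f : Cube n → Cube m) (S : Set (Cube n)), S.ncard = 2 ^ k → Hides f S → 1 - ε ≤ A.prob f S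

/-- `A` distinguishes with error at most `ε` the functions that hide a subgroup of order `2^k` from
those that hide the trivial subgroup: it accepts the former and rejects the latter, each with
probability at least `1 - ε`. For `1 ≤ k` an algorithm that in addition has to reject all other
functions that do not hide a subgroup of order `2^k` is a special case. -/
def Distinguishes (A : QueryAlgorithm n m Bool) (k : ℕ) (ε : ℝ) : Prop :=
  (∀ (f : Cube n → Cube m) (S : Set (Cube n)), S.ncard = 2 ^ k → Hides f S →
      1 - ε ≤ A.prob f true) ∧
    ∀ f : Cube n → Cube m, Hides f {0} → 1 - ε ≤ A.prob f false

end QueryAlgorithm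

end GenSimon

end

/-! The proof is the polynomial method. After `T` queries the amplitudes have degree at most `T` in
the indicators of `f x = y`, so the probability of any set of outputs has degree at most `2 * T`
(`acceptProb_mem_oracleDegreeLE`). Fix a hyperplane `V` of the cube and average this probability
over `σ ∘ A`, with `σ` a random permutation and `ker A` a random subspace of `V` of dimension `j`.
The average is `q (2 ^ j)` for one real polynomial `q` of degree at most `2 * T`
(`exists_polynomial_hidingAverage`), with values in `[0, 1]` at `1, 2, …, 2 ^ (n - 1)`.

A low-degree polynomial bounded at geometric nodes is nearly constant far below the largest ones:
interpolation at the top `2 * T + 1` nodes bounds `q (2 ^ k) - q 1`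
(`eval_two_pow_sub_eval_one_le`). A correct algorithm forces this gap to be large, hence `T` to be
large (`queries_bound_of_gap`).

For a distinguisher the gap is at least `1 - 2 * ε`. For an algorithm that finds `S`, the event is
that the output is a `k`-dimensional subspace of `V`. It has probability at least `1 - ε` when such
a subspace is hidden. Since a given `k`-dimensional subspace lies in a fraction of at most `2 ^
(-k)` of all hyperplanes, some `V` makes the event that unlikely on random injective functions
(`exists_hidingAverage_subspacesInKer_le`). -/

noncomputable section

/-! ### Acceptance probabilities as low-degree polynomials in the oracle -/

namespace GenSimon

open Classical in
/-- The indicator of `f` agreeing with all the input-output pairs in `s`. -/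
def agreeIndicator {n m : ℕ} (s : Finset (Cube n × Cube m)) (f : Cube n → Cube m) : ℝ :=
  if ∀ p ∈ s, f p.1 = p.2 then 1 else 0

/-- Real functions of `f` that are polynomials of degree at most `d` in the indicators of
`f x = y`. -/
def oracleDegreeLE (n m d : ℕ) : Submodule ℝ ((Cube n → Cube m) → ℝ) :=
  Submodule.span ℝ {F | ∃ s : Finset (Cube n × Cube m), s.card ≤ d ∧ F = agreeIndicator s}

variable {n m : ℕ}

theorem agreeIndicator_mul (s t : Finset (Cube n × Cube m)) :
    agreeIndicator s * agreeIndicator t = agreeIndicator (s ∪ t) := by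
  classical
  funext f
  simp only [agreeIndicator, Pi.mul_apply, Finset.mem_union, or_imp, forall_and, ite_and, ite_mul,
    one_mul, zero_mul]

theorem mul_mem_oracleDegreeLE {a b : ℕ} {F G : (Cube n → Cube m) → ℝ}
    (hF : F ∈ oracleDegreeLE n m a) (hG : G ∈ oracleDegreeLE n m b) :
    F * G ∈ oracleDegreeLE n m (a + b) := by
  classical
  refine Submodule.span_induction (p := fun F _ => F * G ∈ oracleDegreeLE n m (a + b))
    ?_ ?_ ?_ ?_ hF
  · rintro _ ⟨s, hs, rfl⟩
    refine Submodule.span_induction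
      (p := fun G _ => agreeIndicator s * G ∈ oracleDegreeLE n m (a + b)) ?_ ?_ ?_ ?_ hG
    · rintro _ ⟨t, ht, rfl⟩
      rw [agreeIndicator_mul]
      exact Submodule.subset_span
        ⟨_, (Finset.card_union_le s t).trans (Nat.add_le_add hs ht), rfl⟩
    · simp
    · intro x y _ _ hx hy
      rw [mul_add]
      exact add_mem hx hy
    · intro c x _ hx
      rw [mul_smul_comm]
      exact Submodule.smul_mem _ c hx
  · simp
  · intro x y _ _ hx hy
    rw [add_mul]
    exact add_mem hx hy
  · intro c x _ hx
    rw [smul_mul_assoc]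
    exact Submodule.smul_mem _ c hx

theorem const_mem_oracleDegreeLE (c : ℝ) (d : ℕ) : (fun _ => c) ∈ oracleDegreeLE n m d := by
  have : (fun _ => c) = c • agreeIndicator (∅ : Finset (Cube n × Cube m)) := by
    funext f
    simp [agreeIndicator]
  rw [this]
  exact Submodule.smul_mem _ c (Submodule.subset_span ⟨∅, by simp, rfl⟩)

open Classical in
theorem ite_eq_mem_oracleDegreeLE (x : Cube n) (y : Cube m) :
    (fun f : Cube n → Cube m => if f x = y then (1 : ℝ) else 0) ∈ oracleDegreeLE n m 1 :=
  Submodule.subset_span ⟨{(x, y)}, by simp, by funext f; simp [agreeIndicator]⟩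

theorem sum_mem_oracleDegreeLE {ι : Type*} (s : Finset ι) {d : ℕ}
    {F : ι → (Cube n → Cube m) → ℝ} (h : ∀ i ∈ s, F i ∈ oracleDegreeLE n m d) :
    (fun f => ∑ i ∈ s, F i f) ∈ oracleDegreeLE n m d := by
  have := Submodule.sum_mem _ h
  convert this using 1
  funext f
  simp

theorem const_mul_mem_oracleDegreeLE (c : ℝ) {d : ℕ} {F : (Cube n → Cube m) → ℝ}
    (h : F ∈ oracleDegreeLE n m d) : (fun f => c * F f) ∈ oracleDegreeLE n m d :=
  Submodule.smul_mem _ c h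

/-- A query at `b` depends on `f` through one new value: expanding over the possible `y = f b.1`
costs a single extra indicator factor. -/
theorem oracle_shift_mem_oracleDegreeLE {w d : ℕ} {F : (Cube n → Cube m) → Label n m w → ℝ}
    (h : ∀ b, (fun f => F f b) ∈ oracleDegreeLE n m d) (b : Label n m w) :
    (fun f => F f (b.1, b.2.1 + f b.1, b.2.2)) ∈ oracleDegreeLE n m (d + 1) := by
  classical
  have e : (fun f => F f (b.1, b.2.1 + f b.1, b.2.2)) =
      fun f => ∑ y : Cube m, ((fun f => F f (b.1, b.2.1 + y, b.2.2)) *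
        fun f : Cube n → Cube m => if f b.1 = y then (1 : ℝ) else 0) f := by
    funext f
    simp
  rw [e]
  exact sum_mem_oracleDegreeLE _ fun y _ =>
    mul_mem_oracleDegreeLE (h _) (ite_eq_mem_oracleDegreeLE _ _)

namespace QueryAlgorithm

variable {Out : Type}

theorem state_mem_oracleDegreeLE (A : QueryAlgorithm n m Out) (t : ℕ) (b : Label n m A.work) :
    (fun f => (A.state f t b).re) ∈ oracleDegreeLE n m t ∧
      (fun f => (A.state f t b).im) ∈ oracleDegreeLE n m t := by
  induction t generalizing b with
  | zero => exact ⟨const_mem_oracleDegreeLE (A.state 0 0 b).re 0,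
      const_mem_oracleDegreeLE (A.state 0 0 b).im 0⟩
  | succ t ih =>
    have hre := oracle_shift_mem_oracleDegreeLE (fun b => (ih b).1)
    have him := oracle_shift_mem_oracleDegreeLE (fun b => (ih b).2)
    simp only [state, Matrix.mulVec, dotProduct, Complex.re_sum, Complex.im_sum, Complex.mul_re,
      Complex.mul_im, oracle]
    constructor
    · exact sum_mem_oracleDegreeLE _ fun c _ => sub_mem
        (const_mul_mem_oracleDegreeLE _ (hre c)) (const_mul_mem_oracleDegreeLE _ (him c))
    · exact sum_mem_oracleDegreeLE _ fun c _ => add_mem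
        (const_mul_mem_oracleDegreeLE _ (him c)) (const_mul_mem_oracleDegreeLE _ (hre c))

open Classical in
/-- The probability that the output of `A` lies in `P` when its oracle is `f`. -/
def acceptProb (A : QueryAlgorithm n m Out) (P : Set Out) (f : Cube n → Cube m) : ℝ :=
  ∑ b : Label n m A.work, if A.output b ∈ P then ‖A.state f A.queries b‖ ^ 2 else 0

theorem acceptProb_mem_oracleDegreeLE (A : QueryAlgorithm n m Out) (P : Set Out) :
    A.acceptProb P ∈ oracleDegreeLE n m (2 * A.queries) := by
  classical
  refine sum_mem_oracleDegreeLE _ fun b _ => ?_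
  split_ifs with h
  · obtain ⟨h1, h2⟩ := A.state_mem_oracleDegreeLE A.queries b
    have := add_mem (mul_mem_oracleDegreeLE h1 h1) (mul_mem_oracleDegreeLE h2 h2)
    rw [← two_mul] at this
    convert this using 1
    funext f
    rw [← Complex.normSq_eq_norm_sq, Complex.normSq_apply]
    rfl
  · exact const_mem_oracleDegreeLE _ _

theorem sum_norm_sq_mulVec {ι : Type*} [Fintype ι] [DecidableEq ι]
    (U : Matrix.unitaryGroup ι ℂ) (v : ι → ℂ) :
    ∑ b, ‖Matrix.mulVec U.1 v b‖ ^ 2 = ∑ b, ‖v b‖ ^ 2 := by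
  have key : ∀ v : ι → ℂ, ((∑ b, ‖v b‖ ^ 2 : ℝ) : ℂ) = star v ⬝ᵥ v := by
    intro v
    simp only [dotProduct, Pi.star_apply, RCLike.star_def, Complex.conj_mul']
    push_cast
    rfl
  have hU : U.1.conjTranspose * U.1 = 1 := Unitary.coe_star_mul_self U
  apply Complex.ofReal_injective
  rw [key, key, Matrix.star_mulVec, Matrix.dotProduct_mulVec, Matrix.vecMul_vecMul, hU,
    Matrix.vecMul_one]

theorem sum_norm_sq_oracle {w : ℕ} (f : Cube n → Cube m) (v : Label n m w → ℂ) :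
    ∑ b, ‖oracle f v b‖ ^ 2 = ∑ b, ‖v b‖ ^ 2 := by
  simp only [oracle, Fintype.sum_prod_type]
  exact Finset.sum_congr rfl fun x _ =>
    Equiv.sum_comp (Equiv.addRight (f x)) fun y => ∑ z, ‖v (x, y, z)‖ ^ 2

theorem sum_norm_sq_state (A : QueryAlgorithm n m Out) (f : Cube n → Cube m) (t : ℕ) :
    ∑ b, ‖A.state f t b‖ ^ 2 = 1 := by
  classical
  induction t with
  | zero =>
    rw [state, sum_norm_sq_mulVec, Finset.sum_eq_single A.start] <;> simp +contextual
  | succ t ih => rw [state, sum_norm_sq_mulVec, sum_norm_sq_oracle, ih]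

theorem acceptProb_nonneg (A : QueryAlgorithm n m Out) (P : Set Out) (f : Cube n → Cube m) :
    0 ≤ A.acceptProb P f := by
  classical
  exact Finset.sum_nonneg fun b _ => by split_ifs <;> positivity

theorem acceptProb_le_of_subset (A : QueryAlgorithm n m Out) {P Q : Set Out} (h : P ⊆ Q)
    (f : Cube n → Cube m) : A.acceptProb P f ≤ A.acceptProb Q f := by
  classical
  refine Finset.sum_le_sum fun b _ => ?_
  by_cases hP : A.output b ∈ P
  · simp [hP, h hP]
  · simp only [hP, if_false]
    split_ifs <;> positivity

theorem acceptProb_univ (A : QueryAlgorithm n m Out) (f : Cube n → Cube m) :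
    A.acceptProb Set.univ f = 1 := by
  simpa [acceptProb] using A.sum_norm_sq_state f A.queries

theorem acceptProb_le_one (A : QueryAlgorithm n m Out) (P : Set Out) (f : Cube n → Cube m) :
    A.acceptProb P f ≤ 1 :=
  (A.acceptProb_le_of_subset (Set.subset_univ P) f).trans_eq (A.acceptProb_univ f)

theorem acceptProb_singleton (A : QueryAlgorithm n m Out) (o : Out) (f : Cube n → Cube m) :
    A.acceptProb {o} f = A.prob f o := by
  classical
  exact Finset.sum_congr rfl fun _ _ => if_congr Set.mem_singleton_iff rfl rfl

theorem acceptProb_add_compl (A : QueryAlgorithm n m Out) (P : Set Out) (f : Cube n → Cube m) :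
    A.acceptProb P f + A.acceptProb Pᶜ f = 1 := by
  classical
  rw [← A.acceptProb_univ f, acceptProb, acceptProb, acceptProb, ← Finset.sum_add_distrib]
  refine Finset.sum_congr rfl fun b _ => ?_
  by_cases hP : A.output b ∈ P <;> simp [hP]

/-- Averaging over a family of sets of outputs such that every output lies in at most `c` of
them. -/
theorem sum_acceptProb_le (A : QueryAlgorithm n m Out) {ι : Type*} (s : Finset ι)
    (P : ι → Set Out) (c : ℕ) (hc : ∀ o, {i | i ∈ s ∧ o ∈ P i}.ncard ≤ c) (f : Cube n → Cube m) :
    ∑ i ∈ s, A.acceptProb (P i) f ≤ c := by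
  classical
  simp only [acceptProb]
  rw [Finset.sum_comm]
  calc _ ≤ ∑ b, c * ‖A.state f A.queries b‖ ^ 2 := Finset.sum_le_sum fun b _ => by
        rw [← Finset.sum_filter, Finset.sum_const, nsmul_eq_mul]
        refine mul_le_mul_of_nonneg_right ?_ (by positivity)
        have h := hc (A.output b)
        have e : {i | i ∈ s ∧ A.output b ∈ P i} =
            ((s.filter fun i => A.output b ∈ P i : Finset ι) : Set ι) := by
          ext; simp
        rw [e, Set.ncard_coe_finset] at h
        exact_mod_cast h
    _ = c := by rw [← Finset.mul_sum, A.sum_norm_sq_state, mul_one]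

end QueryAlgorithm

end GenSimon

end

/-! ### Polynomials bounded at geometric nodes -/

open Finset in
-- Telescoping: the factors have absolute value at most 1, so exchanging `y` for `z` in the factor
-- at `i` costs at most `(y - z) * w i`.
theorem abs_prod_one_sub_sub_le {ι : Type*} (s : Finset ι) (w : ι → ℝ) {y z : ℝ}
    (hw : ∀ i ∈ s, 0 ≤ w i ∧ w i ≤ 1) (hz : 0 ≤ z) (hzy : z ≤ y) (hy : y ≤ 1) :
    |∏ i ∈ s, (1 - y * w i) - ∏ i ∈ s, (1 - z * w i)| ≤ (y - z) * ∑ i ∈ s, w i := by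
  classical
  induction s using Finset.induction_on with
  | empty => simp
  | insert a s ha ih =>
    rw [prod_insert ha, prod_insert ha, sum_insert ha]
    have ih' := ih fun i hi => hw i (mem_insert_of_mem hi)
    obtain ⟨h0, h1⟩ := hw a (mem_insert_self a s)
    set P := ∏ i ∈ s, (1 - y * w i)
    set R := ∏ i ∈ s, (1 - z * w i)
    have hR : |R| ≤ 1 := by
      rw [abs_prod]
      refine prod_le_one (fun i _ => abs_nonneg _) fun i hi => ?_
      obtain ⟨h2, h3⟩ := hw i (mem_insert_of_mem hi)
      rw [abs_le]
      constructor <;> nlinarith [mul_nonneg hz h2]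
    have hya : |1 - y * w a| ≤ 1 := by
      rw [abs_le]
      constructor <;> nlinarith [mul_nonneg (hz.trans hzy) h0]
    have e : (1 - y * w a) * P - (1 - z * w a) * R
        = (1 - y * w a) * (P - R) - (y - z) * w a * R := by ring
    rw [e]
    refine (abs_sub _ _).trans ?_
    rw [abs_mul, abs_mul, abs_of_nonneg (mul_nonneg (sub_nonneg.2 hzy) h0)]
    have h4 := mul_le_mul hya ih' (abs_nonneg _) zero_le_one
    have h5 := mul_le_mul_of_nonneg_left hR (mul_nonneg (sub_nonneg.2 hzy) h0)
    linarith

/-- Lipschitz constant on `[0, 1]` of interpolation at the nodes `1, 2, …, 2 ^ d`, for values in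
`[-1, 1]`. -/
noncomputable def geometricLipschitz (d : ℕ) : ℝ :=
  ∑ j ∈ Finset.range (d + 1),
    (∏ i ∈ (Finset.range (d + 1)).erase j, |(2 : ℝ) ^ i / (2 ^ j - 2 ^ i)|) *
      ∑ i ∈ (Finset.range (d + 1)).erase j, ((2 : ℝ) ^ i)⁻¹

open Polynomial Finset in
theorem abs_eval_sub_eval_le_geometricLipschitz {q : ℝ[X]} {d : ℕ} (hq : q.natDegree ≤ d)
    (hb : ∀ i ≤ d, |q.eval (2 ^ i)| ≤ 1 / 2) {y z : ℝ} (hz : 0 ≤ z) (hzy : z ≤ y) (hy : y ≤ 1) :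
    |q.eval y - q.eval z| ≤ (y - z) / 2 * geometricLipschitz d := by
  have hinj : Function.Injective fun i : ℕ => (2 : ℝ) ^ i :=
    pow_right_injective₀ (by norm_num) (by norm_num)
  have hint := Lagrange.eq_interpolate (s := range (d + 1)) (v := fun i : ℕ => (2 : ℝ) ^ i) (f := q)
    hinj.injOn (by
      rw [card_range]
      exact lt_of_le_of_lt degree_le_natDegree (by exact_mod_cast Nat.lt_succ_of_le hq))
  -- Lagrange interpolation with `x - 2 ^ i` written as `-2 ^ i * (1 - x / 2 ^ i)`, so that `x`
  -- enters only through products of the kind bounded above.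
  have hev : ∀ x : ℝ, q.eval x = ∑ j ∈ range (d + 1), q.eval (2 ^ j) *
      ((∏ i ∈ (range (d + 1)).erase j, (2 : ℝ) ^ i / (2 ^ j - 2 ^ i)) *
        (-1) ^ #((range (d + 1)).erase j) *
        ∏ i ∈ (range (d + 1)).erase j, (1 - x * ((2 : ℝ) ^ i)⁻¹)) := by
    intro x
    conv_lhs => rw [hint]
    simp only [Lagrange.interpolate_apply, eval_finsetSum, eval_mul, eval_C, Lagrange.basis,
      eval_prod, Lagrange.basisDivisor, eval_sub, eval_X]
    refine sum_congr rfl fun j _ => ?_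
    congr 1
    rw [← prod_const, ← prod_mul_distrib, ← prod_mul_distrib]
    refine prod_congr rfl fun i hi => ?_
    have : (2 : ℝ) ^ j - 2 ^ i ≠ 0 := sub_ne_zero.2 fun h => (mem_erase.1 hi).1 (hinj h).symm
    field_simp
    ring
  rw [hev y, hev z, ← sum_sub_distrib, geometricLipschitz, mul_sum]
  refine (abs_sum_le_sum_abs _ _).trans (sum_le_sum fun j hj => ?_)
  rw [← mul_sub, ← mul_sub, abs_mul, abs_mul, abs_mul, abs_pow, abs_neg, abs_one, one_pow, mul_one,
    abs_prod]
  have h1 := abs_prod_one_sub_sub_le ((range (d + 1)).erase j) (fun i => ((2 : ℝ) ^ i)⁻¹)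
    (fun i _ => ⟨by positivity, inv_le_one_of_one_le₀ (one_le_pow₀ (by norm_num))⟩) hz hzy hy
  have h2 := hb j (Nat.lt_succ_iff.1 (mem_range.1 hj))
  have h3 : 0 ≤ ∏ i ∈ (range (d + 1)).erase j, |(2 : ℝ) ^ i / (2 ^ j - 2 ^ i)| :=
    prod_nonneg fun _ _ => abs_nonneg _
  refine (mul_le_mul h2 (mul_le_mul_of_nonneg_left h1 h3) (by positivity) (by norm_num)).trans
    (le_of_eq (by ring))

theorem geometricLipschitz_zero : geometricLipschitz 0 = 0 := by
  simp [geometricLipschitz]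

/-- The exact value serves the case of one query, where the general bound `2 ^ (d + 2) = 16` is too
weak. -/
theorem geometricLipschitz_two : geometricLipschitz 2 = 5 := by
  have h0 : (Finset.range 3).erase 0 = {1, 2} := by decide
  have h1 : (Finset.range 3).erase 1 = {0, 2} := by decide
  have h2 : (Finset.range 3).erase 2 = {0, 1} := by decide
  simp only [geometricLipschitz, Finset.sum_range_succ, Finset.sum_range_zero, Nat.reduceAdd, h0, h1, h2]
  norm_num [abs_of_nonneg, abs_of_neg, abs_div]

open Finset in
-- In the `j`-th product the factors with `i < j` are at most 1 and the `d - j` factors with `i > j`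
-- at most 2. Both remaining sums are geometric.
theorem geometricLipschitz_le (d : ℕ) : geometricLipschitz d ≤ 2 ^ (d + 2) := by
  have hfac : ∀ j ∈ range (d + 1),
      ∏ i ∈ (range (d + 1)).erase j, |(2 : ℝ) ^ i / (2 ^ j - 2 ^ i)| ≤ 2 ^ (d - j) := by
    intro j hj
    have hle : ∀ i ∈ (range (d + 1)).erase j,
        |(2 : ℝ) ^ i / (2 ^ j - 2 ^ i)| ≤ if j < i then 2 else 1 := by
      intro i hi
      have hij := (mem_erase.1 hi).1
      rw [abs_div, abs_of_pos (by positivity : (0 : ℝ) < 2 ^ i)]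
      split_ifs with h
      · obtain ⟨e, rfl⟩ := Nat.exists_eq_add_of_lt h
        have h1 : (1 : ℝ) ≤ 2 ^ e := one_le_pow₀ (by norm_num)
        have h2 : (0 : ℝ) < 2 ^ j := by positivity
        have h3 : (2 : ℝ) ^ (j + e + 1) = 2 ^ j * 2 ^ e * 2 := by ring
        rw [h3, abs_of_neg (by nlinarith), div_le_iff₀ (by nlinarith)]
        nlinarith
      · obtain ⟨e, rfl⟩ := Nat.exists_eq_add_of_lt (lt_of_le_of_ne (not_lt.1 h) hij)
        have h1 : (1 : ℝ) ≤ 2 ^ e := one_le_pow₀ (by norm_num)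
        have h2 : (0 : ℝ) < 2 ^ i := by positivity
        have h3 : (2 : ℝ) ^ (i + e + 1) = 2 ^ i * 2 ^ e * 2 := by ring
        rw [h3, abs_of_pos (by nlinarith), div_le_iff₀ (by nlinarith)]
        nlinarith
    refine (prod_le_prod (fun _ _ => abs_nonneg _) hle).trans ?_
    rw [prod_ite, prod_const, prod_const_one, mul_one]
    refine pow_le_pow_right₀ (by norm_num) ?_
    calc _ ≤ #(Ioc j d) := card_le_card fun i hi => by
          simp only [mem_filter, mem_erase, mem_range, mem_Ioc] at hi ⊢
          omega
      _ = d - j := by simp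
  have hsum : ∀ j, ∑ i ∈ (range (d + 1)).erase j, ((2 : ℝ) ^ i)⁻¹ ≤ 2 := by
    intro j
    refine (sum_le_sum_of_subset_of_nonneg (erase_subset _ _) fun _ _ _ => by positivity).trans ?_
    have := sum_geometric_two_le (d + 1)
    simpa using this
  calc geometricLipschitz d ≤ ∑ j ∈ range (d + 1), (2 : ℝ) ^ (d - j) * 2 :=
        sum_le_sum fun j hj => mul_le_mul (hfac j hj) (hsum j)
          (sum_nonneg fun _ _ => by positivity) (by positivity)
    _ = (∑ j ∈ range (d + 1), (2 : ℝ) ^ j) * 2 := by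
        rw [← sum_mul]
        have := sum_range_reflect (fun j => (2 : ℝ) ^ j) (d + 1)
        simpa using this
    _ ≤ _ := by
        rw [geom_sum_eq (by norm_num)]
        have : (0 : ℝ) < 2 ^ d := by positivity
        rw [pow_add, pow_add]
        linarith

open Polynomial in
/-- A real polynomial of degree at most `d` with values in `[0, 1]` at `1, 2, …, 2 ^ M` is almost
constant on `[1, 2 ^ k]` when `k` and `d` are small compared with `M`. -/
theorem eval_two_pow_sub_eval_one_le {q : ℝ[X]} {d k M : ℕ} (hq : q.natDegree ≤ d)
    (hb : ∀ i ≤ M, 0 ≤ q.eval (2 ^ i) ∧ q.eval (2 ^ i) ≤ 1) (hd : k + d ≤ M) :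
    q.eval (2 ^ k) - q.eval 1 ≤ (2 ^ k - 1) / 2 ^ (M - d) / 2 * geometricLipschitz d := by
  set D : ℝ := 2 ^ (M - d) with hD
  have hDpos : 0 < D := by positivity
  -- Rescaling by `D` turns the top nodes `2 ^ (M - d), …, 2 ^ M` into `1, …, 2 ^ d` and moves `1`
  -- and `2 ^ k` into `[0, 1]`; subtracting `1 / 2` centres the values in `[-1 / 2, 1 / 2]`.
  set r : ℝ[X] := q.comp (C D * X) - C (1 / 2) with hr
  have hre : ∀ x, r.eval x = q.eval (D * x) - 1 / 2 := fun x => by simp [hr]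
  have hrd : r.natDegree ≤ d := by
    refine (natDegree_sub_le _ _).trans (max_le ?_ (by simp))
    refine natDegree_comp_le.trans ?_
    calc q.natDegree * (C D * X).natDegree ≤ d * 1 := Nat.mul_le_mul hq ((natDegree_C_mul_le D X).trans natDegree_X_le)
      _ = d := mul_one d
  have hk1 : (1 : ℝ) ≤ 2 ^ k := one_le_pow₀ (by norm_num)
  have h := abs_eval_sub_eval_le_geometricLipschitz hrd (y := 2 ^ k / D) (z := 1 / D)
    (fun i hi => by
      rw [hre, hD, ← pow_add, abs_le]
      have := hb (M - d + i) (by omega)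
      constructor <;> linarith [this.1, this.2])
    (by positivity) (by gcongr)
    ((div_le_one hDpos).2 (pow_le_pow_right₀ (by norm_num) (by omega)))
  rw [hre, hre, mul_div_cancel₀ _ hDpos.ne', mul_div_cancel₀ _ hDpos.ne'] at h
  have e : ((2 : ℝ) ^ k / D - 1 / D) = (2 ^ k - 1) / D := by ring
  rw [e] at h
  have := (le_abs_self _).trans h
  linarith

/-! ### Counting automorphisms: random subspaces containing or avoiding given vectors -/

noncomputable section

open Module

/-- The number of automorphisms of `V` that map `w` into `H`, for linearly independent `w`, in terms
of the numbers of linearly independent families. -/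
theorem card_linearEquiv_map_mem_mul {K V : Type*} [Field K] [AddCommGroup V] [Module K V]
    [Finite V] (H : Submodule K V) {r : ℕ} (w : Fin r → V) (hw : LinearIndependent K w) :
    Nat.card {g : V ≃ₗ[K] V // ∀ i, g (w i) ∈ H} *
        Nat.card {s : Fin r → V // LinearIndependent K s} =
      Nat.card (V ≃ₗ[K] V) * Nat.card {s : Fin r → H // LinearIndependent K s} := by
  classical
  have htrans : ∀ w' : {s : Fin r → V // LinearIndependent K s},
      ∃ g : V ≃ₗ[K] V, ∀ i, g (w i) = w'.1 i := by
    intro w'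
    obtain ⟨g, hg⟩ := Submodule.exists_linearEquiv_restrict_eq
      ((Basis.span hw).equiv (Basis.span w'.2) (Equiv.refl _))
    refine ⟨g, fun i => ?_⟩
    have h1 := hg (Basis.span hw i)
    rw [Basis.equiv_apply, Basis.span_apply, Basis.span_apply] at h1
    exact h1.symm
  choose τ hτ using htrans
  have hli : ∀ (g : V ≃ₗ[K] V) (s : Fin r → V), LinearIndependent K s →
      LinearIndependent K fun i => g (s i) := fun g s hs =>
    hs.map' g.toLinearMap (LinearMap.ker_eq_bot.2 g.injective)
  let back : (V ≃ₗ[K] V) × {s : Fin r → H // LinearIndependent K s} →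
      {s : Fin r → V // LinearIndependent K s} := fun p =>
    ⟨fun i => p.1.symm (p.2.1 i), hli p.1.symm _ (p.2.2.map' H.subtype H.ker_subtype)⟩
  have hτ' : ∀ w' i, (τ w').symm (w'.1 i) = w i := fun w' i => by
    rw [LinearEquiv.symm_apply_eq, hτ]
  rw [← Nat.card_prod, ← Nat.card_prod]
  -- The bijection sends `(g, w')` to `(g ∘ (τ w')⁻¹, g ∘ w)`. From an image `(h, s)` one recovers
  -- `w' = h⁻¹ ∘ s`, then `g = h ∘ τ w'`.
  refine Nat.card_congr
    { toFun := fun p => ⟨(τ p.2).symm ≪≫ₗ p.1.1, ⟨fun i => ⟨p.1.1 (w i), p.1.2 i⟩,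
        LinearIndependent.of_comp H.subtype (hli p.1.1 w hw)⟩⟩
      invFun := fun p => ⟨⟨τ (back p) ≪≫ₗ p.1, fun i => by simp [hτ, back]⟩, back p⟩
      left_inv := ?_
      right_inv := ?_ }
  · rintro ⟨⟨g, hg⟩, w'⟩
    have e : back ((τ w').symm ≪≫ₗ g, ⟨fun i => ⟨g (w i), hg i⟩,
        LinearIndependent.of_comp H.subtype (hli g w hw)⟩) = w' := by
      apply Subtype.ext
      funext i
      simp [back, hτ]
    simp only [e]
    refine Prod.ext (Subtype.ext ?_) rfl
    ext x
    simp
  · rintro ⟨h, s, hs⟩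
    refine Prod.ext ?_ (Subtype.ext ?_)
    · ext x
      simp
    · funext i
      apply Subtype.ext
      simp [hτ, back]

open Polynomial in
/-- The probability that a random subspace of order `2 ^ j` of a space over `𝔽₂` contains a given
subspace of dimension `r` is a polynomial of degree at most `r` in `2 ^ j`. -/
theorem exists_polynomial_card_linearEquiv {V : Type*} [AddCommGroup V] [Module (ZMod 2) V]
    [Finite V] (W : Submodule (ZMod 2) V) :
    ∃ q : ℝ[X], q.natDegree ≤ finrank (ZMod 2) W ∧ ∀ H : Submodule (ZMod 2) V,
      (Nat.card {g : V ≃ₗ[ZMod 2] V // W ≤ H.map g.toLinearMap} : ℝ) =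
        q.eval (2 ^ finrank (ZMod 2) H) := by
  classical
  set r := finrank (ZMod 2) W with hr
  have hrV : r ≤ finrank (ZMod 2) V := Submodule.finrank_le W
  let b : Basis (Fin r) (ZMod 2) W := Module.finBasis _ _
  have hw : LinearIndependent (ZMod 2) fun i => (b i : V) :=
    b.linearIndependent.map' W.subtype W.ker_subtype
  set N : ℝ := ∏ i : Fin r, ((2 : ℝ) ^ finrank (ZMod 2) V - 2 ^ i.val) with hN
  have hNpos : 0 < N := Finset.prod_pos fun i _ =>
    sub_pos.2 (pow_lt_pow_right₀ (by norm_num) (i.2.trans_le hrV))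
  refine ⟨C ((Nat.card (V ≃ₗ[ZMod 2] V) : ℝ) / N) * ∏ i : Fin r, (X - C ((2 : ℝ) ^ i.val)), ?_, ?_⟩
  · refine (natDegree_C_mul_le _ _).trans ?_
    refine (natDegree_prod_le _ _).trans ?_
    exact (Finset.sum_le_sum fun i _ => natDegree_X_sub_C_le _).trans (by simp)
  intro H
  have hli : (Nat.card {s : Fin r → H // LinearIndependent (ZMod 2) s} : ℝ) =
      ∏ i : Fin r, ((2 : ℝ) ^ finrank (ZMod 2) H - 2 ^ i.val) := by
    by_cases hH : r ≤ finrank (ZMod 2) H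
    · rw [card_linearIndependent hH, ZMod.card]
      push_cast
      refine Finset.prod_congr rfl fun i _ => ?_
      rw [Nat.cast_sub (Nat.pow_le_pow_right (by norm_num) (i.2.le.trans hH))]
      push_cast
      rfl
    · have : IsEmpty {s : Fin r → H // LinearIndependent (ZMod 2) s} :=
        ⟨fun s => hH (by simpa using s.2.fintype_card_le_finrank)⟩
      rw [Nat.card_of_isEmpty, Nat.cast_zero]
      -- When `H` is too small to contain `r` independent vectors, the factor with `i = finrank H`
      -- vanishes, so the same polynomial also covers these `H`.
      exact (Finset.prod_eq_zero (Finset.mem_univ ⟨_, not_le.1 hH⟩) (by simp)).symm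
  have hV : (Nat.card {s : Fin r → V // LinearIndependent (ZMod 2) s} : ℝ) = N := by
    rw [card_linearIndependent hrV, ZMod.card]
    push_cast
    refine Finset.prod_congr rfl fun i _ => ?_
    rw [Nat.cast_sub (Nat.pow_le_pow_right (by norm_num) (i.2.le.trans hrV))]
    push_cast
    rfl
  have hcard : Nat.card {g : V ≃ₗ[ZMod 2] V // W ≤ H.map g.toLinearMap} =
      Nat.card {g : V ≃ₗ[ZMod 2] V // ∀ i, g (b i : V) ∈ H} := by
    refine Nat.card_congr
      ((Equiv.mk (fun g => g.symm) (fun g => g.symm) (fun _ => rfl) fun _ => rfl).subtypeEquiv ?_)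
    intro g
    have hspan : W = Submodule.span (ZMod 2) (Set.range fun i => (b i : V)) := by
      have := congrArg (Submodule.map W.subtype) b.span_eq
      rw [Submodule.map_span, Submodule.map_top, Submodule.range_subtype, ← Set.range_comp] at this
      exact this.symm
    conv_lhs => rw [hspan]
    rw [Submodule.span_le, Set.range_subset_iff]
    refine forall_congr' fun i => ?_
    rw [SetLike.mem_coe, Submodule.mem_map_equiv]
    rfl
  have := card_linearEquiv_map_mem_mul H (fun i => (b i : V)) hw
  rw [← hcard] at this
  have h2 := congrArg (Nat.cast : ℕ → ℝ) this
  push_cast at h2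
  rw [hli, hV] at h2
  rw [eval_mul, eval_C, eval_prod]
  simp only [eval_sub, eval_X, eval_C]
  rw [div_mul_eq_mul_div, eq_div_iff hNpos.ne', h2]

open Polynomial in
/-- Random subspaces of `V ≤ E` that contain `W` and avoid a finite set `s`. -/
theorem exists_polynomial_card_linearEquiv_avoid {E : Type*} [AddCommGroup E] [Module (ZMod 2) E]
    [Finite E] (V X : Submodule (ZMod 2) E) (s : Finset E) (hs : (s : Set E) ⊆ X) :
    ∀ W ≤ X, ∃ q : ℝ[X], q.natDegree ≤ finrank (ZMod 2) X ∧ ∀ H : Submodule (ZMod 2) V,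
      (Nat.card {g : V ≃ₗ[ZMod 2] V // W ≤ (H.map g.toLinearMap).map V.subtype ∧
          ∀ e ∈ s, e ∉ (H.map g.toLinearMap).map V.subtype} : ℝ) =
        q.eval (2 ^ finrank (ZMod 2) H) := by
  classical
  induction s using Finset.induction_on with
  | empty =>
    intro W hW
    simp only [Finset.notMem_empty, false_imp_iff, implies_true, and_true]
    by_cases hWV : W ≤ V
    · obtain ⟨q, hq, h⟩ := exists_polynomial_card_linearEquiv (W.comap V.subtype)
      refine ⟨q, hq.trans ?_, fun H => ?_⟩
      · rw [(Submodule.comapSubtypeEquivOfLe hWV).finrank_eq]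
        exact Submodule.finrank_mono hW
      · rw [← h]
        congr 1
        refine Nat.card_congr (Equiv.subtypeEquivRight fun g => ?_)
        conv_lhs => rw [← inf_eq_right.2 hWV, ← Submodule.map_comap_subtype]
        exact Submodule.map_le_map_iff_of_injective V.injective_subtype _ _
    · refine ⟨0, by simp, fun H => ?_⟩
      have : IsEmpty {g : V ≃ₗ[ZMod 2] V // W ≤ (H.map g.toLinearMap).map V.subtype} :=
        ⟨fun g => hWV (g.2.trans (Submodule.map_subtype_le _ _))⟩
      simp
  | insert a s _ ih =>
    intro W hW
    rw [Finset.coe_insert, Set.insert_subset_iff] at hs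
    obtain ⟨q₁, hq₁, h₁⟩ := ih hs.2 W hW
    obtain ⟨q₂, hq₂, h₂⟩ := ih hs.2 (W ⊔ Submodule.span _ {a})
      (sup_le hW ((Submodule.span_singleton_le_iff_mem _ _).2 hs.1))
    -- Inclusion-exclusion on `a`: from the images that contain `W` and avoid `s`, remove those that
    -- also contain `a`. Every subspace required stays inside `X`, so the degree does not grow.
    refine ⟨q₁ - q₂, (natDegree_sub_le _ _).trans (max_le hq₁ hq₂), fun H => ?_⟩
    rw [eval_sub, ← h₁, ← h₂, eq_sub_iff_add_eq, ← Nat.cast_add]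
    congr 1
    have : Finite (V ≃ₗ[ZMod 2] V) := DFunLike.finite _
    have := Fintype.ofFinite (V ≃ₗ[ZMod 2] V)
    simp only [Nat.card_eq_fintype_card, Fintype.card_subtype]
    rw [← Finset.card_union_of_disjoint]
    · congr 1
      ext g
      simp only [Finset.mem_union, Finset.mem_filter, Finset.mem_univ, true_and, Finset.mem_insert,
        forall_eq_or_imp, sup_le_iff, Submodule.span_singleton_le_iff_mem]
      tauto
    · rw [Finset.disjoint_left]
      intro g
      simp only [Finset.mem_filter, Finset.mem_univ, true_and, Finset.mem_insert,
        forall_eq_or_imp, sup_le_iff, Submodule.span_singleton_le_iff_mem]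
      tauto

end

/-! ### Averages over random hiding functions -/

noncomputable section

open Module

theorem Finset.exists_perm_eqOn {α : Type*} [Finite α] (s : Finset α) (f : α → α)
    (hf : Set.InjOn f s) : ∃ τ : Equiv.Perm α, ∀ x ∈ s, τ x = f x := by
  classical
  have := Fintype.ofFinite α
  obtain ⟨g, hg⟩ := Finset.exists_equiv_extend_of_card_eq (α := α) (β := α) (t := Finset.univ)
    (by simp) (Finset.subset_univ (s.image f)) hf
  exact ⟨g.trans (Equiv.subtypeUnivEquiv Finset.mem_univ), hg⟩

/-- The number of permutations that map `a p.1` to `p.2` for all `p ∈ s` does not depend on `a`, as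
long as there is one. -/
theorem card_perm_agree {α β : Type*} [Finite β] (s : Finset (α × β)) (a : α → β)
    (ha : ∀ p ∈ s, ∀ p' ∈ s, a p.1 = a p'.1 ↔ p.2 = p'.2) :
    Nat.card {σ : Equiv.Perm β // ∀ p ∈ s, σ (a p.1) = p.2} =
      Nat.card {σ : Equiv.Perm β // ∀ p ∈ s, σ p.2 = p.2} := by
  classical
  have hsel : ∀ y : β, ∃ z, ∀ p ∈ s, p.2 = y → z = a p.1 := by
    intro y
    by_cases h : ∃ p ∈ s, p.2 = y
    · obtain ⟨p, hp, rfl⟩ := h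
      exact ⟨a p.1, fun p' hp' h' => (ha p hp p' hp').2 h'.symm⟩
    · exact ⟨y, fun p hp hy => (h ⟨p, hp, hy⟩).elim⟩
  choose z hz using hsel
  -- Right multiplication by a permutation `τ` with `τ p.2 = a p.1` on `s` identifies the two sets.
  obtain ⟨τ, hτ⟩ := Finset.exists_perm_eqOn (s.image Prod.snd) z (by
    intro y hy y' hy' h
    obtain ⟨p, hp, rfl⟩ := Finset.mem_image.1 (Finset.mem_coe.1 hy)
    obtain ⟨p', hp', rfl⟩ := Finset.mem_image.1 (Finset.mem_coe.1 hy')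
    rw [hz _ p hp rfl, hz _ p' hp' rfl] at h
    exact (ha p hp p' hp').1 h)
  have hτ' : ∀ p ∈ s, τ p.2 = a p.1 := fun p hp => by
    rw [hτ _ (Finset.mem_image_of_mem _ hp), hz _ p hp rfl]
  refine Nat.card_congr ((Equiv.mulRight τ).subtypeEquiv fun σ => ?_)
  refine forall₂_congr fun p hp => ?_
  rw [Equiv.coe_mulRight, Equiv.Perm.mul_apply, hτ' p hp]

theorem Submodule.exists_linearMap_ker_eq {K E F : Type*} [Field K] [AddCommGroup E] [Module K E]
    [AddCommGroup F] [Module K F] [FiniteDimensional K E] [FiniteDimensional K F]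
    (h : finrank K E ≤ finrank K F) (H : Submodule K E) :
    ∃ A : E →ₗ[K] F, LinearMap.ker A = H := by
  obtain ⟨f, hf⟩ := (finrank_le_iff_exists_linearMap (R := K) (M := E ⧸ H) (M' := F)).1
    ((Submodule.finrank_quotient_le H).trans h)
  exact ⟨f ∘ₗ H.mkQ, by rw [LinearMap.ker_comp_of_ker_eq_bot _ (LinearMap.ker_eq_bot.2 hf),
    Submodule.ker_mkQ]⟩

theorem Submodule.exists_finrank_eq {K V : Type*} [Field K] [AddCommGroup V] [Module K V]
    [FiniteDimensional K V] {j : ℕ} (hj : j ≤ finrank K V) :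
    ∃ H : Submodule K V, finrank K H = j := by
  obtain ⟨f, hf⟩ := (finrank_le_iff_exists_linearMap (R := K) (M := Fin j → K) (M' := V)).1
    (by simpa using hj)
  exact ⟨LinearMap.range f, by rw [LinearMap.finrank_range_of_inj hf]; simp⟩

namespace GenSimon

variable {n m : ℕ}

/-- A linear map with a prescribed kernel. -/
def mapWithKer (hnm : n ≤ m) (H : Submodule (ZMod 2) (Cube n)) : Cube n →ₗ[ZMod 2] Cube m :=
  (Submodule.exists_linearMap_ker_eq (by simpa using hnm) H).choose

theorem ker_mapWithKer (hnm : n ≤ m) (H : Submodule (ZMod 2) (Cube n)) :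
    LinearMap.ker (mapWithKer hnm H) = H :=
  (Submodule.exists_linearMap_ker_eq (by simpa using hnm) H).choose_spec

theorem mapWithKer_eq_iff (hnm : n ≤ m) (H : Submodule (ZMod 2) (Cube n)) (x y : Cube n) :
    mapWithKer hnm H x = mapWithKer hnm H y ↔ x + y ∈ H := by
  conv_rhs => rw [← ker_mapWithKer hnm H, ← ZModModule.sub_eq_add]
  rw [LinearMap.sub_mem_ker_iff]

/-- The function `σ ∘ A` with `ker A = H`, which hides `H`. -/
def hidingFun (hnm : n ≤ m) (H : Submodule (ZMod 2) (Cube n)) (σ : Equiv.Perm (Cube m)) :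
    Cube n → Cube m := fun x => σ (mapWithKer hnm H x)

theorem hides_hidingFun (hnm : n ≤ m) (H : Submodule (ZMod 2) (Cube n))
    (σ : Equiv.Perm (Cube m)) : Hides (hidingFun hnm H σ) H := fun x y => by
  rw [hidingFun, hidingFun, σ.injective.eq_iff, mapWithKer_eq_iff, SetLike.mem_coe]

theorem ncard_submodule (H : Submodule (ZMod 2) (Cube n)) :
    (H : Set (Cube n)).ncard = 2 ^ finrank (ZMod 2) H := by
  rw [← Nat.card_coe_set_eq]
  have := Module.natCard_eq_pow_finrank (K := ZMod 2) (V := H)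
  rw [Nat.card_zmod] at this
  exact this

/-- The image in the cube of a subspace of `V` under an automorphism of `V`. -/
def moved {V : Submodule (ZMod 2) (Cube n)} (H : Submodule (ZMod 2) V) (g : V ≃ₗ[ZMod 2] V) :
    Submodule (ZMod 2) (Cube n) :=
  (H.map g.toLinearMap).map V.subtype

instance (V : Submodule (ZMod 2) (Cube n)) : Finite (V ≃ₗ[ZMod 2] V) := DFunLike.finite _

instance (V : Submodule (ZMod 2) (Cube n)) : Fintype (V ≃ₗ[ZMod 2] V) := Fintype.ofFinite _

/-- The average of `F` over random functions that hide a random image of `H`. -/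
def hidingAverage (hnm : n ≤ m) {V : Submodule (ZMod 2) (Cube n)} (H : Submodule (ZMod 2) V)
    (F : (Cube n → Cube m) → ℝ) : ℝ :=
  (∑ g : V ≃ₗ[ZMod 2] V, ∑ σ : Equiv.Perm (Cube m), F (hidingFun hnm (moved H g) σ)) /
    (Fintype.card (V ≃ₗ[ZMod 2] V) * Fintype.card (Equiv.Perm (Cube m)))

theorem le_hidingAverage (hnm : n ≤ m) {V : Submodule (ZMod 2) (Cube n)}
    (H : Submodule (ZMod 2) V) (F : (Cube n → Cube m) → ℝ) {c : ℝ}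
    (h : ∀ g σ, c ≤ F (hidingFun hnm (moved H g) σ)) : c ≤ hidingAverage hnm H F := by
  rw [hidingAverage, le_div_iff₀ (by positivity)]
  refine le_trans (le_of_eq ?_) (Finset.sum_le_sum fun g _ => Finset.sum_le_sum fun σ _ => h g σ)
  simp only [Finset.sum_const, nsmul_eq_mul, Finset.card_univ]
  ring

theorem hidingAverage_le (hnm : n ≤ m) {V : Submodule (ZMod 2) (Cube n)}
    (H : Submodule (ZMod 2) V) (F : (Cube n → Cube m) → ℝ) {c : ℝ}
    (h : ∀ g σ, F (hidingFun hnm (moved H g) σ) ≤ c) : hidingAverage hnm H F ≤ c := by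
  rw [hidingAverage, div_le_iff₀ (by positivity)]
  refine (Finset.sum_le_sum fun g _ => Finset.sum_le_sum fun σ _ => h g σ).trans (le_of_eq ?_)
  simp only [Finset.sum_const, nsmul_eq_mul, Finset.card_univ]
  ring

open Polynomial in
-- Some `σ ∘ A` fits the pairs in `s` exactly when `ker A` contains `x + x'` for pairs with equal
-- answers and avoids it for pairs with different answers; the number of such `σ` then does not
-- depend on `A`. All these sums lie in the span of the inputs, of dimension at most `s.card`, which
-- bounds the degree.
theorem exists_polynomial_hidingAverage_agreeIndicator (hnm : n ≤ m)
    (V : Submodule (ZMod 2) (Cube n)) (s : Finset (Cube n × Cube m)) :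
    ∃ q : ℝ[X], q.natDegree ≤ s.card ∧ ∀ H : Submodule (ZMod 2) V,
      hidingAverage hnm H (agreeIndicator s) = q.eval (2 ^ finrank (ZMod 2) H) := by
  classical
  let X' : Submodule (ZMod 2) (Cube n) := Submodule.span _ (s.image Prod.fst : Finset (Cube n))
  have hX : ∀ p ∈ s, ∀ p' ∈ s, p.1 + p'.1 ∈ X' := fun p hp p' hp' =>
    add_mem (Submodule.subset_span (Finset.mem_coe.2 (Finset.mem_image_of_mem _ hp)))
      (Submodule.subset_span (Finset.mem_coe.2 (Finset.mem_image_of_mem _ hp')))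
  let same : Set (Cube n) := {e | ∃ p ∈ s, ∃ p' ∈ s, p.2 = p'.2 ∧ p.1 + p'.1 = e}
  let diff : Finset (Cube n) :=
    ((s ×ˢ s).filter fun t => t.1.2 ≠ t.2.2).image fun t => t.1.1 + t.2.1
  obtain ⟨q, hq, hqe⟩ := exists_polynomial_card_linearEquiv_avoid V X' diff
    (by
      intro e he
      simp only [diff, Finset.coe_image, Finset.coe_filter, Set.mem_image, Set.mem_ofPred_eq,
        Finset.mem_product] at he
      obtain ⟨t, ⟨⟨h1, h2⟩, -⟩, rfl⟩ := he
      exact hX _ h1 _ h2)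
    (Submodule.span (ZMod 2) same)
    (Submodule.span_le.2 (by
      rintro e ⟨p, hp, p', hp', -, rfl⟩
      exact hX _ hp _ hp'))
  have hXs : finrank (ZMod 2) X' ≤ s.card :=
    (finrank_span_finset_le_card _).trans Finset.card_image_le
  set N : ℝ := Fintype.card (V ≃ₗ[ZMod 2] V) * Fintype.card (Equiv.Perm (Cube m)) with hN
  set c : ℕ := Nat.card {σ : Equiv.Perm (Cube m) // ∀ p ∈ s, σ p.2 = p.2} with hc
  refine ⟨C (c / N) * q, (natDegree_C_mul_le _ _).trans (hq.trans hXs), fun H => ?_⟩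
  rw [eval_mul, eval_C, ← hqe H, hidingAverage, ← hN, div_mul_eq_mul_div]
  congr 1
  have hcons : ∀ K : Submodule (ZMod 2) (Cube n),
      (Submodule.span (ZMod 2) same ≤ K ∧ ∀ e ∈ diff, e ∉ K) ↔
        ∀ p ∈ s, ∀ p' ∈ s, mapWithKer hnm K p.1 = mapWithKer hnm K p'.1 ↔ p.2 = p'.2 := by
    intro K
    simp only [mapWithKer_eq_iff]
    constructor
    · rintro ⟨h1, h2⟩ p hp p' hp'
      constructor
      · intro h
        by_contra hne
        exact h2 _ (Finset.mem_image.2 ⟨(p, p'), by simp [hp, hp', hne], rfl⟩) h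
      · intro h
        exact h1 (Submodule.subset_span ⟨p, hp, p', hp', h, rfl⟩)
    · intro h
      constructor
      · rw [Submodule.span_le]
        rintro e ⟨p, hp, p', hp', he, rfl⟩
        exact (h p hp p' hp').2 he
      · intro e he hK
        obtain ⟨t, ht, rfl⟩ := Finset.mem_image.1 he
        simp only [Finset.mem_filter, Finset.mem_product] at ht
        exact ht.2 ((h _ ht.1.1 _ ht.1.2).1 hK)
  have hinner : ∀ K : Submodule (ZMod 2) (Cube n),
      ∑ σ : Equiv.Perm (Cube m), agreeIndicator s (hidingFun hnm K σ) =
        if (Submodule.span (ZMod 2) same ≤ K ∧ ∀ e ∈ diff, e ∉ K) then (c : ℝ) else 0 := by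
    intro K
    simp only [hcons]
    split_ifs with h
    · simp only [agreeIndicator]
      rw [Finset.sum_boole, hc, ← card_perm_agree s _ h]
      congr 1
      exact (Nat.subtype_card _ fun σ => by
        rw [Finset.mem_filter]
        exact and_iff_right (Finset.mem_univ σ)).symm
    · refine Finset.sum_eq_zero fun σ _ => if_neg fun hσ => h fun p hp p' hp' => ?_
      rw [← hσ p hp, ← hσ p' hp', hidingFun, hidingFun, σ.injective.eq_iff]
  simp only [hinner, moved]
  rw [← Finset.sum_filter, Finset.sum_const, nsmul_eq_mul, Nat.card_eq_fintype_card,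
    Fintype.card_subtype, mul_comm]

open Polynomial in
/-- The average over random functions hiding a subspace of `V` of order `2 ^ j` is a polynomial
in `2 ^ j`. -/
theorem exists_polynomial_hidingAverage (hnm : n ≤ m) (V : Submodule (ZMod 2) (Cube n)) {d : ℕ}
    {F : (Cube n → Cube m) → ℝ} (hF : F ∈ oracleDegreeLE n m d) :
    ∃ q : ℝ[X], q.natDegree ≤ d ∧ ∀ H : Submodule (ZMod 2) V,
      hidingAverage hnm H F = q.eval (2 ^ finrank (ZMod 2) H) := by
  refine Submodule.span_induction (p := fun F _ => ∃ q : ℝ[X], q.natDegree ≤ d ∧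
    ∀ H : Submodule (ZMod 2) V, hidingAverage hnm H F = q.eval (2 ^ finrank (ZMod 2) H))
    ?_ ?_ ?_ ?_ hF
  · rintro _ ⟨s, hs, rfl⟩
    obtain ⟨q, hq, h⟩ := exists_polynomial_hidingAverage_agreeIndicator hnm V s
    exact ⟨q, hq.trans hs, h⟩
  · exact ⟨0, by simp, fun H => by simp [hidingAverage]⟩
  · rintro F G _ _ ⟨q, hq, h⟩ ⟨r, hr, h'⟩
    refine ⟨q + r, natDegree_add_le_of_degree_le hq hr, fun H => ?_⟩
    rw [eval_add, ← h, ← h']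
    simp only [hidingAverage, Pi.add_apply, Finset.sum_add_distrib, add_div]
  · rintro c F _ ⟨q, hq, h⟩
    refine ⟨C c * q, (natDegree_C_mul_le _ _).trans hq, fun H => ?_⟩
    rw [eval_mul, eval_C, ← h]
    simp only [hidingAverage, Pi.smul_apply, smul_eq_mul, ← Finset.mul_sum, mul_div_assoc]

end GenSimon

end

/-! ### From the gap to the query bound -/

noncomputable section

open Module

namespace GenSimon

variable {n m : ℕ}

theorem finrank_moved {V : Submodule (ZMod 2) (Cube n)} (H : Submodule (ZMod 2) V)
    (g : V ≃ₗ[ZMod 2] V) : finrank (ZMod 2) (moved H g) = finrank (ZMod 2) H := by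
  rw [moved, Submodule.finrank_map_subtype_eq]
  exact LinearEquiv.finrank_map_eq g H

theorem moved_le {V : Submodule (ZMod 2) (Cube n)} (H : Submodule (ZMod 2) V)
    (g : V ≃ₗ[ZMod 2] V) : moved H g ≤ V := Submodule.map_subtype_le _ _

theorem moved_bot {V : Submodule (ZMod 2) (Cube n)} (g : V ≃ₗ[ZMod 2] V) :
    moved (⊥ : Submodule (ZMod 2) V) g = ⊥ := by
  simp [moved]

theorem hidingAverage_bot (hnm : n ≤ m) (V : Submodule (ZMod 2) (Cube n))
    (F : (Cube n → Cube m) → ℝ) :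
    hidingAverage hnm (⊥ : Submodule (ZMod 2) V) F =
      (∑ σ : Equiv.Perm (Cube m), F (hidingFun hnm ⊥ σ)) / Fintype.card (Equiv.Perm (Cube m)) := by
  simp only [hidingAverage, moved_bot, Finset.sum_const, nsmul_eq_mul, Finset.card_univ]
  exact mul_div_mul_left _ _ (by exact_mod_cast Fintype.card_ne_zero)

/-- The polynomial method: an acceptance probability that, on average, changes between functions
hiding the trivial group and functions hiding subspaces of a hyperplane of order `2 ^ k`. -/
theorem gap_le_geometricLipschitz (hnm : n ≤ m) {Out : Type} (A : QueryAlgorithm n m Out)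
    (P : Set Out) (V : Submodule (ZMod 2) (Cube n)) (H : Submodule (ZMod 2) V)
    (hd : finrank (ZMod 2) H + 2 * A.queries ≤ finrank (ZMod 2) V) {a b : ℝ}
    (ha : hidingAverage hnm (⊥ : Submodule (ZMod 2) V) (A.acceptProb P) ≤ a)
    (hb : b ≤ hidingAverage hnm H (A.acceptProb P)) :
    b - a ≤ (2 ^ finrank (ZMod 2) H - 1) / 2 ^ (finrank (ZMod 2) V - 2 * A.queries) / 2 *
      geometricLipschitz (2 * A.queries) := by
  obtain ⟨q, hq, h⟩ := exists_polynomial_hidingAverage hnm V (A.acceptProb_mem_oracleDegreeLE P)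
  have key := eval_two_pow_sub_eval_one_le hq (k := finrank (ZMod 2) H) (M := finrank (ZMod 2) V)
    (fun i hi => by
      obtain ⟨K, hK⟩ := Submodule.exists_finrank_eq hi
      rw [← hK, ← h K]
      exact ⟨le_hidingAverage _ _ _ fun _ _ => A.acceptProb_nonneg P _,
        hidingAverage_le _ _ _ fun _ _ => A.acceptProb_le_one P _⟩) hd
  have h0 := h ⊥
  rw [finrank_bot, pow_zero] at h0
  rw [← h, ← h0] at key
  linarith

/-- A bound on the Lipschitz constant that governs algorithms with `T` queries. -/
theorem geometricLipschitz_le_eight_pow (T : ℕ) (hT : 1 ≤ T) :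
    (2 : ℝ) ^ (2 * T) * geometricLipschitz (2 * T) * 8 ≤ 2 ^ (8 * T) := by
  obtain rfl | hT := hT.eq_or_lt
  · norm_num [geometricLipschitz_two]
  · calc (2 : ℝ) ^ (2 * T) * geometricLipschitz (2 * T) * 8
        ≤ 2 ^ (2 * T) * 2 ^ (2 * T + 2) * 2 ^ 3 := by
          have := geometricLipschitz_le (2 * T)
          norm_num
          gcongr
      _ = 2 ^ (4 * T + 5) := by ring
      _ ≤ _ := pow_le_pow_right₀ (by norm_num) (by omega)

/-- The numerical core of the query bound. -/
theorem queries_bound_of_gap {ε B : ℝ} (hε : ε < 1 / 2) {n k M T : ℕ} (hk : 1 ≤ k) (hM : M + 1 = n)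
    (hT : 4 * T < n - k) (hB : B = geometricLipschitz (2 * T))
    (hgap : (1 - 1 / 2 ^ k) * (1 - 2 * ε) ≤ (2 ^ k - 1) / 2 ^ (M - 2 * T) / 2 * B) :
    1 ≤ T ∧ (n : ℝ) - k + 3 + Real.logb 2 (1 - 2 * ε) ≤ 8 * T := by
  have hδ : 0 < 1 - 2 * ε := by linarith
  have hk1 : (2 : ℝ) ≤ 2 ^ k := by
    calc (2 : ℝ) = 2 ^ 1 := by norm_num
      _ ≤ 2 ^ k := pow_le_pow_right₀ (by norm_num) hk
  -- With this `e` both sides of `hgap` carry the factor `(2 ^ k - 1) / 2 ^ k`, which cancels.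
  obtain ⟨e, he⟩ : ∃ e, M = k + 2 * T + e := ⟨M - (k + 2 * T), by omega⟩
  have hpow : (2 : ℝ) ^ (M - 2 * T) = 2 ^ k * 2 ^ e := by
    rw [← pow_add]
    congr 1
    omega
  have hδB : (1 - 2 * ε) * 2 ^ (e + 1) ≤ B := by
    have e1 : (1 - 1 / (2 : ℝ) ^ k) * (1 - 2 * ε) =
        ((2 ^ k - 1) / 2 ^ k) * (1 - 2 * ε) := by field_simp
    have e2 : ((2 : ℝ) ^ k - 1) / 2 ^ (M - 2 * T) / 2 * B =
        ((2 ^ k - 1) / 2 ^ k) * (B / 2 ^ (e + 1)) := by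
      rw [hpow, pow_succ]
      field_simp
    rw [e1, e2] at hgap
    have h3 : 0 < ((2 : ℝ) ^ k - 1) / 2 ^ k := div_pos (by linarith) (by positivity)
    exact (le_div_iff₀ (by positivity)).1 (le_of_mul_le_mul_left hgap h3)
  -- Without queries `q` is constant and the Lipschitz constant is 0, contradicting the positive
  -- gap.
  have hT1 : 1 ≤ T := by
    by_contra h
    have h0 : T = 0 := by omega
    rw [h0, mul_zero, geometricLipschitz_zero] at hB
    rw [hB] at hδB
    exact absurd hδB (not_le.2 (by positivity))
  refine ⟨hT1, ?_⟩
  have h8 := geometricLipschitz_le_eight_pow T hT1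
  rw [← hB] at h8
  have hfin : (1 - 2 * ε) * 2 ^ (n - k + 3) ≤ 2 ^ (8 * T) := by
    refine le_trans ?_ h8
    have e1 : n - k + 3 = (e + 1) + 2 * T + 3 := by omega
    have h5 := mul_le_mul_of_nonneg_left hδB (by positivity : (0 : ℝ) ≤ 2 ^ (2 * T) * 8)
    rw [e1, pow_add, pow_add]
    linarith
  have hlog := Real.logb_le_logb_of_le (b := 2) (by norm_num) (by positivity) hfin
  rw [Real.logb_mul hδ.ne' (by positivity), Real.logb_pow, Real.logb_pow,
    Real.logb_self_eq_one (by norm_num)] at hlog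
  push_cast [Nat.cast_sub (show k ≤ n by omega)] at hlog
  linarith

theorem finrank_ker_dual {u : Dual (ZMod 2) (Cube n)} (hu : u ≠ 0) :
    finrank (ZMod 2) (LinearMap.ker u) + 1 = n := by
  simpa using Dual.finrank_ker_add_one_of_ne_zero hu

instance : Finite (Dual (ZMod 2) (Cube n)) := DFunLike.finite _

instance : Fintype (Dual (ZMod 2) (Cube n)) := Fintype.ofFinite _

theorem exists_dual_ne_zero (hn : 0 < n) : ∃ u : Dual (ZMod 2) (Cube n), u ≠ 0 :=
  ⟨LinearMap.proj ⟨0, hn⟩, fun h => by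
    simpa using LinearMap.congr_fun h (Pi.single ⟨0, hn⟩ 1)⟩

namespace QueryAlgorithm

/-- Distinguishing algorithms satisfy the query bound. -/
theorem Distinguishes.queries_bound {ε : ℝ} (hε : ε < 1 / 2) {k : ℕ} (hk : 1 ≤ k)
    (hnm : n ≤ m) {A : QueryAlgorithm n m Bool} (hA : A.Distinguishes k ε)
    (hT : 4 * A.queries < n - k) :
    1 ≤ A.queries ∧ (n : ℝ) - k + 3 + Real.logb 2 (1 - 2 * ε) ≤ 8 * A.queries := by
  obtain ⟨u, hu⟩ := exists_dual_ne_zero (n := n) (by omega)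
  have hV := finrank_ker_dual hu
  obtain ⟨H, hH⟩ := Submodule.exists_finrank_eq (K := ZMod 2) (V := LinearMap.ker u) (j := k)
    (by omega)
  refine queries_bound_of_gap hε hk hV hT rfl (le_trans ?_ (hH ▸ gap_le_geometricLipschitz hnm A
    {true} (LinearMap.ker u) H (by omega) (a := ε) (b := 1 - ε) ?_ ?_))
  · have : (0 : ℝ) ≤ 1 / 2 ^ k := by positivity
    nlinarith
  · refine hidingAverage_le _ _ _ fun g σ => ?_
    have h1 := hA.2 (hidingFun hnm ⊥ σ) (by simpa using hides_hidingFun hnm ⊥ σ)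
    rw [← acceptProb_singleton] at h1
    have h2 := A.acceptProb_add_compl {true} (hidingFun hnm ⊥ σ)
    have h3 : ({true} : Set Bool)ᶜ = {false} := by ext b; simp
    rw [h3] at h2
    rw [moved_bot]
    linarith
  · refine le_hidingAverage _ _ _ fun g σ => ?_
    rw [acceptProb_singleton]
    exact hA.1 _ _ (by rw [ncard_submodule, finrank_moved, hH]) (hides_hidingFun hnm _ σ)

/-- The subspaces of dimension `k` in the kernel of `u`, as outputs of an algorithm. -/
def subspacesInKer (k : ℕ) (u : Dual (ZMod 2) (Cube n)) : Set (Set (Cube n)) :=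
  {S | ∃ H : Submodule (ZMod 2) (Cube n), (H : Set (Cube n)) = S ∧ finrank (ZMod 2) H = k ∧
    H ≤ LinearMap.ker u}

/-- The functionals counted are nonzero elements of the annihilator of `S`, which has dimension `n -
k`; if `S` is no `k`-dimensional subspace there are none. -/
theorem ncard_subspacesInKer_le (k : ℕ) (S : Set (Cube n)) :
    {u | u ∈ (Finset.univ.erase 0 : Finset (Dual (ZMod 2) (Cube n))) ∧
      S ∈ subspacesInKer k u}.ncard ≤ 2 ^ (n - k) - 1 := by
  by_cases h : ∃ H : Submodule (ZMod 2) (Cube n), (H : Set (Cube n)) = S ∧ finrank (ZMod 2) H = k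
  · obtain ⟨H, rfl, rfl⟩ := h
    have hsub : {u | u ∈ (Finset.univ.erase 0 : Finset (Dual (ZMod 2) (Cube n))) ∧
        (H : Set (Cube n)) ∈ subspacesInKer (finrank (ZMod 2) H) u} ⊆
        (H.dualAnnihilator : Set (Dual (ZMod 2) (Cube n))) \ {0} := by
      rintro u ⟨hu, K, hK, -, hKu⟩
      refine ⟨?_, by simpa using hu⟩
      obtain rfl := SetLike.coe_injective hK
      rw [SetLike.mem_coe, Submodule.mem_dualAnnihilator]
      exact fun w hw => hKu hw
    refine (Set.ncard_le_ncard hsub (Set.toFinite _)).trans (le_of_eq ?_)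
    rw [Set.ncard_sdiff_singleton_of_mem (by simp), ← Nat.card_coe_set_eq]
    have h1 := Module.natCard_eq_pow_finrank (K := ZMod 2) (V := H.dualAnnihilator)
    have h2 := Subspace.finrank_add_finrank_dualAnnihilator_eq H
    rw [Nat.card_zmod] at h1
    rw [finrank_fin_fun] at h2
    congr 1
    refine h1.trans ?_
    congr 1
    omega
  · have : {u | u ∈ (Finset.univ.erase 0 : Finset (Dual (ZMod 2) (Cube n))) ∧
        S ∈ subspacesInKer k u} = ∅ := by
      ext u
      simp only [Set.mem_ofPred_eq, Set.mem_empty_iff_false, iff_false, not_and]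
      rintro - ⟨H, hH, hk, -⟩
      exact h ⟨H, hH, hk⟩
    rw [this, Set.ncard_empty]
    exact Nat.zero_le _

/-- On random injective functions, an algorithm has probability at most `2 ^ (-k)` to output a
subspace of dimension `k` of a suitable hyperplane. -/
theorem exists_hidingAverage_subspacesInKer_le (hnm : n ≤ m) (hn : 0 < n) {k : ℕ} (hk : k ≤ n)
    (A : QueryAlgorithm n m (Set (Cube n))) :
    ∃ u : Dual (ZMod 2) (Cube n), u ≠ 0 ∧
      hidingAverage hnm (⊥ : Submodule (ZMod 2) (LinearMap.ker u))
        (A.acceptProb (subspacesInKer k u)) ≤ 1 / 2 ^ k := by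
  classical
  by_contra! hcon
  have hcard : ((Finset.univ.erase 0 : Finset (Dual (ZMod 2) (Cube n))).card : ℝ) = 2 ^ n - 1 := by
    have h1 := Module.natCard_eq_pow_finrank (K := ZMod 2) (V := Dual (ZMod 2) (Cube n))
    rw [Nat.card_zmod, Subspace.dual_finrank_eq, finrank_fin_fun, Nat.card_eq_fintype_card] at h1
    rw [Finset.card_erase_of_mem (Finset.mem_univ _), Finset.card_univ, h1,
      Nat.cast_sub Nat.one_le_two_pow]
    push_cast
    rfl
  obtain ⟨u₀, hu₀⟩ := exists_dual_ne_zero hn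
  have hlt := Finset.sum_lt_sum_of_nonempty
    (s := (Finset.univ.erase 0 : Finset (Dual (ZMod 2) (Cube n)))) ⟨u₀, by simp [hu₀]⟩
    fun u hu => hcon u (Finset.ne_of_mem_erase hu)
  rw [Finset.sum_const, nsmul_eq_mul, hcard] at hlt
  -- For the trivial subgroup the oracle distribution does not depend on `u`, so the sums over `u`
  -- and `σ` can be exchanged and each output counted against all hyperplanes.
  simp only [hidingAverage_bot] at hlt
  rw [← Finset.sum_div, Finset.sum_comm, lt_div_iff₀ (by positivity)] at hlt
  have hle : ∀ σ ∈ (Finset.univ : Finset (Equiv.Perm (Cube m))),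
      ∑ u ∈ (Finset.univ.erase 0 : Finset (Dual (ZMod 2) (Cube n))),
        A.acceptProb (subspacesInKer k u) (hidingFun hnm ⊥ σ) ≤ 2 ^ (n - k) - 1 := fun σ _ => by
    have := A.sum_acceptProb_le _ (subspacesInKer k) _ (ncard_subspacesInKer_le k)
      (hidingFun hnm ⊥ σ)
    rw [Nat.cast_sub Nat.one_le_two_pow] at this
    exact_mod_cast this
  have h2 := hlt.trans_le (Finset.sum_le_sum hle)
  rw [Finset.sum_const, nsmul_eq_mul, Finset.card_univ, mul_comm] at h2
  have h3 := lt_of_mul_lt_mul_left h2 (by positivity)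
  have h4 : (2 : ℝ) ^ n * (1 / 2 ^ k) = 2 ^ (n - k) := by
    rw [mul_one_div, pow_sub₀ _ (by norm_num) hk, div_eq_mul_inv]
  have h5 : 1 / (2 : ℝ) ^ k ≤ 1 :=
    (div_le_one (by positivity)).2 (one_le_pow₀ (by norm_num))
  rw [sub_mul, h4] at h3
  linarith

/-- Algorithms that find the hidden subgroup satisfy the query bound. -/
theorem Solves.queries_bound {ε : ℝ} (hε0 : 0 ≤ ε) (hε : ε < 1 / 2) {k : ℕ} (hk : 1 ≤ k)
    (hnm : n ≤ m) {A : QueryAlgorithm n m (Set (Cube n))} (hA : A.Solves k ε)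
    (hT : 4 * A.queries < n - k) :
    1 ≤ A.queries ∧ (n : ℝ) - k + 3 + Real.logb 2 (1 - 2 * ε) ≤ 8 * A.queries := by
  obtain ⟨u, hu, hα⟩ := exists_hidingAverage_subspacesInKer_le hnm (by omega) (k := k) (by omega) A
  have hV := finrank_ker_dual hu
  obtain ⟨H, hH⟩ := Submodule.exists_finrank_eq (K := ZMod 2) (V := LinearMap.ker u) (j := k)
    (by omega)
  refine queries_bound_of_gap hε hk hV hT rfl (le_trans ?_ (hH ▸ gap_le_geometricLipschitz hnm A
    (subspacesInKer k u) (LinearMap.ker u) H (by omega) (b := 1 - ε) hα ?_))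
  -- For `p = 2 ^ (-k)`, the inequality `(1 - p) * (1 - 2 * ε) ≤ 1 - ε - p` amounts to `2 * p * ε ≤
  -- ε`, hence `p ≤ 1 / 2` suffices.
  · have : 1 / (2 : ℝ) ^ k ≤ 1 / 2 ^ 1 :=
      one_div_le_one_div_of_le (by norm_num) (pow_le_pow_right₀ (by norm_num) hk)
    nlinarith
  · refine le_hidingAverage _ _ _ fun g σ => ?_
    refine (hA (hidingFun hnm (moved H g) σ) (moved H g)
      (by rw [ncard_submodule, finrank_moved, hH]) (hides_hidingFun hnm _ σ)).trans ?_
    rw [← acceptProb_singleton]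
    refine A.acceptProb_le_of_subset (Set.singleton_subset_iff.2 ?_) _
    exact ⟨moved H g, rfl, by rw [finrank_moved, hH], moved_le H g⟩

end QueryAlgorithm

/-- Both forms of the bound, from the one for few queries. -/
theorem min_le_and_linear_le {ε : ℝ} (hε0 : 0 ≤ ε) (hε : ε < 1 / 2) {n k T : ℕ} (hkn : k ≤ n)
    (h : 4 * T < n - k → 1 ≤ T ∧ (n : ℝ) - k + 3 + Real.logb 2 (1 - 2 * ε) ≤ 8 * T) :
    min (((n : ℝ) - k) / 4) (((n : ℝ) - k + 3 + Real.logb 2 (1 - 2 * ε)) / 8) ≤ T ∧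
      (16 - Real.logb 2 (1 - 2 * ε))⁻¹ * ((n : ℝ) - k) ≤ T := by
  have hl : Real.logb 2 (1 - 2 * ε) ≤ 0 :=
    Real.logb_nonpos (by norm_num) (by linarith) (by linarith)
  set l := Real.logb 2 (1 - 2 * ε)
  have hc : 0 < 16 - l := by linarith
  rw [inv_mul_le_iff₀ hc]
  by_cases hT : 4 * T < n - k
  · obtain ⟨h1, h2⟩ := h hT
    have h1' : (1 : ℝ) ≤ T := by exact_mod_cast h1
    refine ⟨(min_le_right _ _).trans (by linarith), ?_⟩
    -- As `T ≥ 1` and `l ≤ 0`, the additive term `-l` is at most `-l * T`, so `n - k ≤ (8 - l) * T`.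
    nlinarith
  · have h3 : (n : ℝ) - k ≤ 4 * T := by
      have : n ≤ 4 * T + k := by omega
      have : (n : ℝ) ≤ 4 * T + k := by exact_mod_cast this
      linarith
    refine ⟨(min_le_left _ _).trans (by linarith), ?_⟩
    have h4 : (0 : ℝ) ≤ T := by positivity
    nlinarith

end GenSimon

end

theorem theorem3 (ε : ℝ) (hε0 : 0 ≤ ε) (hε : ε < 1 / 2) :
    ∃ c : ℝ, 0 < c ∧ ∀ n m k : ℕ, 1 ≤ k → k ≤ n → n ≤ m →
      (∀ A : GenSimon.QueryAlgorithm n m (Set (GenSimon.Cube n)), A.Solves k ε →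
        min (((n : ℝ) - k) / 4) (((n : ℝ) - k + 3 + Real.logb 2 (1 - 2 * ε)) / 8) ≤ A.queries ∧
        c * ((n : ℝ) - k) ≤ A.queries) ∧
      (∀ A : GenSimon.QueryAlgorithm n m Bool, A.Distinguishes k ε →
        min (((n : ℝ) - k) / 4) (((n : ℝ) - k + 3 + Real.logb 2 (1 - 2 * ε)) / 8) ≤ A.queries ∧
        c * ((n : ℝ) - k) ≤ A.queries) := by
  have hl : Real.logb 2 (1 - 2 * ε) ≤ 0 :=
    Real.logb_nonpos (by norm_num) (by linarith) (by linarith)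
  refine ⟨(16 - Real.logb 2 (1 - 2 * ε))⁻¹, inv_pos.2 (by linarith), fun n m k hk hkn hnm => ?_⟩
  exact ⟨fun A hA => GenSimon.min_le_and_linear_le hε0 hε hkn fun hT =>
      hA.queries_bound hε0 hε hk hnm hT,
    fun A hA => GenSimon.min_le_and_linear_le hε0 hε hkn fun hT =>
      hA.queries_bound hε hk hnm hT⟩
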